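/- Let $d\in\{0,1\}$, and put $h_0=\cosh$, $h_1=\sinh$. Let $(\beta_N)_{N\ge1}$, $(\gamma_N)_{N\ge1}$ be increasing and $(\delta_N)_{N\ge1}$ decreasing sequences of positive numbers with $\beta_N\to\infty$, $\gamma_N\to\infty$, $\delta_N\to0$. A sequence $(P_{2N+d})_{N\ge1}$ of real polynomials is of class $\mathcal P_d(\beta,\gamma,\delta)$ if each $P_{2N+d}$ is monic of degree $2N+d$, is even for $d=0$ and odd for $d=1$, has only real zeros, all of multiplicity $1$, and if there is a constant $K>0$, independent of $N$ and $z$, such that for all $N\ge1$ and all $z\in\mathbb C$ with $|z|\le\gamma_N$ $$\left|\frac{\beta_N^d\,P_{2N+d}(z/\beta_N)}{P_{2N+d}^{(d)}(0)}-\cos\left(z-\frac{d\pi}{2}\right)\right|\le K\,\delta_N\,\min(|z|^2,1)\,h_d(|z|).$$ For a set $\Omega\subset[0,\infty)$ of $N+2$ knots put $W(u)=\prod_{v\in\Omega}(u-v)$, and define the B-spline and the associated B-spline by $$B_N(t,\Omega)=(N+1)\sum_{v\in\Omega}\frac{(v-t)_+^N}{W'(v)},\qquad B_N^*(t,\Omega)=t^{-N}B_N(t,\Omega),\qquad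 B_N^*(0,\Omega)=\lim_{t\to0+}B_N^*(t,\Omega).$$ **Corollary 3.10.** Let $(P_{2N+d})_{N\ge1}$ be of class $\mathcal P_d(\beta,\gamma,\delta)$, and let $x_k=x_{k,N,d}$, $1\le k\le N$, be the positive zeros of $P_{2N+d}$. Let $(u_N)_{N\ge1}$ be a sequence of positive numbers such that $u_N\notin\{x_{1,N,d},\dots,x_{N,N,d}\}$ for all $N$ and $\lim_{N\to\infty}\beta_Nu_N=\infty$, and let $\Omega_N=\{0,u_N^2,x_{1,N,d}^2,\dots,x_{N,N,d}^2\}$. Then for every $s\in\mathbb C$ with $\operatorname{Re}s>d$ the integrals below converge absolutely, and $$\lim_{N\to\infty}\Gamma\left(1+\frac{s-d}{2}\right)u_N^2\,\beta_N^{s-d}\,N^{-1-(s-d)/2}\prod_{k=1}^N x_{k,N,d}^2\int_0^{\max\Omega_N}B_N^*(t,\Omega_N)\,t^{(s-d)/2-1}\,dt=\int_0^\infty\frac{t^{s/2-1}}{h_d(\sqrt t)}\,dt.$$ For every $r>d$ the convergence is uniform in $s$ on each compact subset of the line $\operatorname{Re}s=r$. -/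

import Mathlib

open Polynomial Filter Topology MeasureTheory

noncomputable section

namespace BSplineLimit

/-- The function `h_d` (on the real line): `cosh` for `d = 0` and `sinh` for `d = 1`. -/
def hyp (d : ℕ) (x : ℝ) : ℝ := if d = 0 then Real.cosh x else Real.sinh x

/-- The class `𝒫_d(β, γ, δ)` for `d ∈ {0, 1}`. All sequences are indexed by `N = 1, 2, …`;
their values at the index `0` are unused. -/
structure ClassP (d : ℕ) (β γ δ : ℕ → ℝ) (P : ℕ → ℝ[X]) : Prop where
  β_pos : ∀ N, 1 ≤ N → 0 < β N
  γ_pos : ∀ N, 1 ≤ N → 0 < γ N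
  δ_pos : ∀ N, 1 ≤ N → 0 < δ N
  β_mono : MonotoneOn β (Set.Ici 1)
  γ_mono : MonotoneOn γ (Set.Ici 1)
  δ_anti : AntitoneOn δ (Set.Ici 1)
  β_lim : Tendsto β atTop atTop
  γ_lim : Tendsto γ atTop atTop
  δ_lim : Tendsto (fun N => (δ N)⁻¹) atTop atTop
  monic : ∀ N, 1 ≤ N → (P N).Monic
  natDegree_eq : ∀ N, 1 ≤ N → (P N).natDegree = 2 * N + d
  /-- `P N` is even for `d = 0` and odd for `d = 1`. -/
  parity : ∀ N, 1 ≤ N → (P N).comp (-X) = (-1) ^ d * P N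
  /-- All zeros are real … -/
  splits : ∀ N, 1 ≤ N → (P N).Splits
  /-- … and have multiplicity one. -/
  simple : ∀ N, 1 ≤ N → (P N).roots.Nodup
  /-- The constant `K` depends on the sequence of polynomials only, not on `N` or `z`. -/
  asymp : ∃ K : ℝ, 0 < K ∧ ∀ N, 1 ≤ N → ∀ z : ℂ, ‖z‖ ≤ γ N →
    ‖(β N : ℂ) ^ d * aeval (z / (β N : ℂ)) (P N) / ((derivative^[d] (P N)).eval 0 : ℝ)
        - Complex.cos (z - d * Real.pi / 2)‖
      ≤ K * (δ N * min (‖z‖ ^ 2) 1 * hyp d ‖z‖)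

/-- The set of positive zeros of a polynomial. -/
def posZeros (p : ℝ[X]) : Finset ℝ := p.roots.toFinset.filter (fun x => 0 < x)

/-- `W(u) = ∏_{v ∈ Ω} (u - v)`, as a polynomial. -/
def knotPoly (Ω : Finset ℝ) : ℝ[X] := ∏ v ∈ Ω, (X - C v)

/-- The B-spline of degree `N` with the set of knots `Ω` (where `Ω` has `N + 2` elements):
`B_N(t, Ω) = (N + 1) ∑_{v ∈ Ω} (v - t)_+^N / W'(v)`. -/
def bSpline (N : ℕ) (Ω : Finset ℝ) (t : ℝ) : ℝ :=
  (N + 1) * ∑ v ∈ Ω, max (v - t) 0 ^ N / (derivative (knotPoly Ω)).eval v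

/-- The associated B-spline `B_N^*(t, Ω) = t^{-N} B_N(t, Ω)` with nonnegative knots; its value
at `0` is the limit from the right. -/
def bSplineStar (N : ℕ) (Ω : Finset ℝ) (t : ℝ) : ℝ :=
  if t = 0 then limUnder (𝓝[>] (0 : ℝ)) (fun τ : ℝ => (τ ^ N)⁻¹ * bSpline N Ω τ)
  else (t ^ N)⁻¹ * bSpline N Ω t

/-- The set of knots `{0, u², x_1², …, x_N²}`, where the `x_k` are the positive zeros of `p`. -/
def knots (p : ℝ[X]) (u : ℝ) : Finset ℝ :=
  insert 0 (insert (u ^ 2) ((posZeros p).image (fun x => x ^ 2)))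

theorem knots_nonempty (p : ℝ[X]) (u : ℝ) : (knots p u).Nonempty :=
  Finset.insert_nonempty _ _

/-- The largest knot. -/
def maxKnot (p : ℝ[X]) (u : ℝ) : ℝ := (knots p u).max' (knots_nonempty p u)

/-- The integrand `B_N^*(t, Ω) t^{(s-d)/2-1}`. -/
def integrandB (d N : ℕ) (p : ℝ[X]) (u : ℝ) (s : ℂ) (t : ℝ) : ℂ :=
  (bSplineStar N (knots p u) t : ℂ) * (t : ℂ) ^ ((s - d) / 2 - 1)

/-- The bracketed expression
`u² b^{s-d} N^{-1-(s-d)/2} (∏ x_k²) ∫_0^{max Ω} B_N^*(t, Ω) t^{(s-d)/2-1} dt`. -/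
def bracket (d N : ℕ) (p : ℝ[X]) (b u : ℝ) (s : ℂ) : ℂ :=
  (u : ℂ) ^ 2 * (b : ℂ) ^ (s - d) * (N : ℂ) ^ (-1 - (s - d) / 2) *
    (∏ x ∈ posZeros p, (x : ℂ) ^ 2) *
    ∫ t in (0 : ℝ)..maxKnot p u, integrandB d N p u s t

/-- The integrand `t^{s/2-1} / h_d(√t)`. -/
def integrandH (d : ℕ) (s : ℂ) (t : ℝ) : ℂ :=
  (t : ℂ) ^ (s / 2 - 1) / (hyp d (Real.sqrt t) : ℂ)

end BSplineLimit

end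

/-! Put σ = (s - d)/2. The B-spline has a generating function: the integral of B_N(t) (t + w)^(-N-2)
over t equals ∏ (v + w)⁻¹ over all knots (`integral_bSpline_div`, from Lagrange interpolation of
X^(N+1)). Multiply by w^σ and integrate over w > 0. By Fubini and the substitution w → t w, the left
side becomes the integral of B_N^*(t) t^(σ-1) times the Mellin transform of (1 + w)^(-N-2) at σ + 1.
On the right the knot 0 contributes w⁻¹, which leaves the Mellin transform at σ of the product over
the positive knots (`integral_bSplineStar_mul_mellin`).

Rescaling w by N on the left and by β_N² on the right absorbs the powers of N and β_N
(`bracket_mul_mellin`): the bracket times the Mellin transform of (1 + t/N)^(-N-2) at σ + 1 is the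
Mellin transform of ∏ (1 + t/(β_N² v))⁻¹ at σ. The first transform tends to Γ(σ + 1). In the second
product the factor of u_N² tends to 1, and the others form the normalized P_{2N+d} at i√t/β_N up to
the factor (i√t)^d, so they tend to h_d(√t)/√t^d.

Both limits pass through the Mellin transform by dominated convergence
(`tendstoUniformlyOn_mellin_inv`). The polynomials have nonnegative coefficients, so values at two
points bound them below by a power of t uniformly in N. Since |t^(σ-1)| depends only on Re σ,
convergence is uniform on whole vertical lines; compactness serves only to bound Γ away from 0
before dividing. -/

noncomputable section

namespace BSplineLimit

/-! ### Dominated convergence for Mellin transforms of reciprocals -/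

/-- A majorant of `t ^ (a - 1) / p t` for functions `p ≥ 1` with `p t ≥ t ^ m` for `t ≥ T`. -/
def mellinMajorant (a T : ℝ) (m : ℕ) (t : ℝ) : ℝ :=
  if t ≤ T then t ^ (a - 1) else t ^ (a - 1 - m)

theorem integrableOn_mellinMajorant {a T : ℝ} {m : ℕ} (ha : 0 < a) (hm : a < m) (hT : 0 < T) :
    IntegrableOn (mellinMajorant a T m) (Set.Ioi 0) := by
  rw [← Set.Ioc_union_Ioi_eq_Ioi hT.le]
  refine IntegrableOn.union ?_ ?_
  · have h : IntegrableOn (fun t : ℝ => t ^ (a - 1)) (Set.Ioc 0 T) :=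
      (intervalIntegrable_iff_integrableOn_Ioc_of_le hT.le).1
        (intervalIntegral.intervalIntegrable_rpow' (by linarith))
    refine h.congr_fun (fun t ht => ?_) measurableSet_Ioc
    simp [mellinMajorant, ht.2]
  · have h : IntegrableOn (fun t : ℝ => t ^ (a - 1 - m)) (Set.Ioi T) :=
      integrableOn_Ioi_rpow_of_lt (by linarith) hT
    refine h.congr_fun (fun t ht => ?_) measurableSet_Ioi
    simp [mellinMajorant, not_le.2 (Set.mem_Ioi.1 ht)]

theorem rpow_mul_inv_le_mellinMajorant {a T x t : ℝ} {m : ℕ} (ht : 0 < t) (h1 : 1 ≤ x)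
    (hm : T ≤ t → t ^ m ≤ x) : t ^ (a - 1) * x⁻¹ ≤ mellinMajorant a T m t := by
  unfold mellinMajorant
  have h0 : 0 < t ^ (a - 1) := Real.rpow_pos_of_pos ht _
  split_ifs with h
  · exact mul_le_of_le_one_right h0.le (inv_le_one_of_one_le₀ h1)
  · rw [Real.rpow_sub ht (a - 1) m, Real.rpow_natCast, div_eq_mul_inv]
    have := hm (not_le.1 h).le
    gcongr

theorem mellinConvergent_inv {f : ℝ → ℝ} {a T : ℝ} {m : ℕ} (ha : 0 < a) (hm : a < m) (hT : 0 < T)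
    (hf : AEStronglyMeasurable (fun t => (f t)⁻¹) (volume.restrict (Set.Ioi 0)))
    (h1 : ∀ t, 0 < t → 1 ≤ f t) (h2 : ∀ t, T ≤ t → t ^ m ≤ f t) {s : ℂ} (hs : s.re = a) :
    MellinConvergent (fun t => (((f t)⁻¹ : ℝ) : ℂ)) s := by
  have hcont : ContinuousOn (fun t : ℝ => (t : ℂ) ^ (s - 1)) (Set.Ioi 0) :=
    ContinuousOn.cpow_const Complex.continuous_ofReal.continuousOn
      (fun t ht => Complex.ofReal_mem_slitPlane.2 ht)
  refine Integrable.mono' (integrableOn_mellinMajorant ha hm hT) ?_ ?_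
  · exact (hcont.aestronglyMeasurable measurableSet_Ioi).smul
      (Complex.continuous_ofReal.comp_aestronglyMeasurable hf)
  · refine (ae_restrict_iff' measurableSet_Ioi).2 (.of_forall fun t (ht : 0 < t) => ?_)
    rw [norm_smul, Complex.norm_cpow_eq_rpow_re_of_pos ht, Complex.norm_real, Complex.sub_re, hs,
      Complex.one_re, Real.norm_of_nonneg (inv_nonneg.2 (by linarith [h1 t ht]))]
    exact rpow_mul_inv_le_mellinMajorant ht (h1 t ht) (h2 t)

theorem one_le_eval_of_coeff_nonneg {p : ℝ[X]} (h0 : p.coeff 0 = 1) (hp : ∀ k, 0 ≤ p.coeff k)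
    {t : ℝ} (ht : 0 ≤ t) : 1 ≤ p.eval t := by
  rw [eval_eq_sum_range, Finset.sum_range_succ', h0]
  have : 0 ≤ ∑ k ∈ Finset.range p.natDegree, p.coeff (k + 1) * t ^ (k + 1) :=
    Finset.sum_nonneg fun k _ => mul_nonneg (hp _) (by positivity)
  simpa using this

/-- A polynomial with nonnegative coefficients which is large at one point `T` grows at least
like a power beyond `T`. -/
theorem pow_mul_sub_le_eval {p : ℝ[X]} (hp : ∀ k, 0 ≤ p.coeff k) {T t : ℝ} (hT : 1 ≤ T)
    (ht : T ≤ t) (m : ℕ) : (t / T) ^ m * (p.eval T - T ^ m * p.eval 1) ≤ p.eval t := by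
  simp only [eval_eq_sum_range, Finset.mul_sum, ← Finset.sum_sub_distrib]
  refine Finset.sum_le_sum fun k _ => ?_
  have hT0 : 0 < T := by linarith
  have ht0 : 0 < t := by linarith
  have hq : 1 ≤ t / T := (one_le_div hT0).2 ht
  -- For `k ≤ m` the subtracted value at 1 makes the left term nonpositive; for `k ≥ m` it is
  -- dropped and `(t / T) ^ m ≤ (t / T) ^ k` suffices.
  rcases le_total k m with h | h
  · have h1 : T ^ k ≤ T ^ m := pow_le_pow_right₀ hT h
    have h2 : (t / T) ^ m * (p.coeff k * T ^ k - T ^ m * (p.coeff k * 1 ^ k)) ≤ 0 := by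
      have : p.coeff k * (T ^ k - T ^ m) ≤ 0 :=
        mul_nonpos_of_nonneg_of_nonpos (hp k) (by linarith)
      refine mul_nonpos_of_nonneg_of_nonpos (by positivity) ?_
      rw [one_pow]
      linarith
    exact h2.trans (mul_nonneg (hp k) (by positivity))
  · have h1 : (t / T) ^ m ≤ (t / T) ^ k := pow_le_pow_right₀ hq h
    have h2 : 0 ≤ T ^ m * (p.coeff k * 1 ^ k) := by
      have := hp k
      positivity
    calc (t / T) ^ m * (p.coeff k * T ^ k - T ^ m * (p.coeff k * 1 ^ k))
        ≤ (t / T) ^ m * (p.coeff k * T ^ k) := by gcongr; linarith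
      _ ≤ (t / T) ^ k * (p.coeff k * T ^ k) := by
          have := hp k
          gcongr
      _ = p.coeff k * t ^ k := by
          rw [div_pow]
          field_simp

theorem eventually_pow_le_eval {p : ℕ → ℝ[X]} {F : ℝ → ℝ}
    (hp : ∀ᶠ N in atTop, ∀ k, 0 ≤ (p N).coeff k)
    (hF : ∀ t, 0 < t → Tendsto (fun N => (p N).eval t) atTop (𝓝 (F t)))
    (hgrow : ∀ (m : ℕ) (C : ℝ), ∃ T, 1 ≤ T ∧ C * T ^ m ≤ F T) (m : ℕ) :
    ∃ T, 1 ≤ T ∧ ∀ᶠ N in atTop, ∀ t, T ≤ t → t ^ m ≤ (p N).eval t := by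
  -- The 3 pays for the error 1 at the point 1, the error 1 at `T` (as `1 ≤ T ^ m`), and the one
  -- copy of `T ^ m` that must remain.
  obtain ⟨T, hT, h⟩ := hgrow m (F 1 + 3)
  refine ⟨T, hT, ?_⟩
  have hT0 : 0 < T := by linarith
  filter_upwards [hp, (hF 1 one_pos).eventually_lt_const (lt_add_one _),
    (hF T hT0).eventually_const_lt (sub_one_lt _)] with N hN h1 h2 t ht
  refine le_trans ?_ (pow_mul_sub_le_eval hN hT ht m)
  have hTm : 1 ≤ T ^ m := one_le_pow₀ hT
  have : T ^ m ≤ (p N).eval T - T ^ m * (p N).eval 1 := by nlinarith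
  calc t ^ m = (t / T) ^ m * T ^ m := by rw [div_pow]; field_simp
    _ ≤ _ := by
      have : 0 ≤ t / T := div_nonneg (by linarith) hT0.le
      gcongr

/-- Mellin transforms of reciprocals of polynomials with nonnegative coefficients converge,
uniformly on vertical lines, if the polynomials converge pointwise to a function that grows
faster than any power. -/
theorem tendstoUniformlyOn_mellin_inv {p : ℕ → ℝ[X]} {F : ℝ → ℝ}
    (hp0 : ∀ᶠ N in atTop, (p N).coeff 0 = 1)
    (hp : ∀ᶠ N in atTop, ∀ k, 0 ≤ (p N).coeff k)
    (hF : ∀ t, 0 < t → Tendsto (fun N => (p N).eval t) atTop (𝓝 (F t)))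
    (hgrow : ∀ (m : ℕ) (C : ℝ), ∃ T, 1 ≤ T ∧ C * T ^ m ≤ F T) {a : ℝ} (ha : 0 < a) :
    (∀ s : ℂ, s.re = a → MellinConvergent (fun t => (((F t)⁻¹ : ℝ) : ℂ)) s) ∧
    (∃ M : ℝ, ∀ s : ℂ, s.re = a → ‖mellin (fun t => (((F t)⁻¹ : ℝ) : ℂ)) s‖ ≤ M) ∧
    TendstoUniformlyOn (fun N s => mellin (fun t => ((((p N).eval t)⁻¹ : ℝ) : ℂ)) s)
      (mellin (fun t => (((F t)⁻¹ : ℝ) : ℂ))) atTop {s | s.re = a} := by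
  obtain ⟨m, hm⟩ := exists_nat_gt a
  obtain ⟨T, hT, hpT⟩ := eventually_pow_le_eval hp hF hgrow m
  have hT0 : 0 < T := by linarith
  have hp1 : ∀ᶠ N in atTop, ∀ t, 0 < t → 1 ≤ (p N).eval t := by
    filter_upwards [hp0, hp] with N h0 h t ht
    exact one_le_eval_of_coeff_nonneg h0 h ht.le
  have hF1 : ∀ t, 0 < t → 1 ≤ F t := fun t ht =>
    ge_of_tendsto (hF t ht) (hp1.mono fun N h => h t ht)
  have hFT : ∀ t, T ≤ t → t ^ m ≤ F t := fun t ht =>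
    ge_of_tendsto (hF t (by linarith)) (hpT.mono fun N h => h t ht)
  have hFlim : ∀ t, 0 < t →
      Tendsto (fun N => ((p N).eval t)⁻¹) atTop (𝓝 (F t)⁻¹) := fun t ht =>
    (hF t ht).inv₀ (by linarith [hF1 t ht])
  have hpmeas : ∀ N, Measurable (fun t => ((p N).eval t)⁻¹) := fun N =>
    ((p N).continuous.measurable).inv
  -- No regularity of `F` is assumed; measurability is inherited from the pointwise limit.
  have hFmeas : AEStronglyMeasurable (fun t => (F t)⁻¹) (volume.restrict (Set.Ioi 0)) :=
    aestronglyMeasurable_of_tendsto_ae atTop (fun N => (hpmeas N).aestronglyMeasurable)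
      ((ae_restrict_iff' measurableSet_Ioi).2 (.of_forall hFlim))
  have hDint := integrableOn_mellinMajorant ha hm hT0
  have hconvF := fun s hs => mellinConvergent_inv (T := T) (m := m) ha hm hT0 hFmeas hF1 hFT (s := s) hs
  refine ⟨hconvF, ⟨∫ t in Set.Ioi 0, mellinMajorant a T m t, fun s hs => ?_⟩, ?_⟩
  · refine norm_integral_le_of_norm_le hDint
      ((ae_restrict_iff' measurableSet_Ioi).2 (.of_forall fun t (ht : 0 < t) => ?_))
    rw [norm_smul, Complex.norm_cpow_eq_rpow_re_of_pos ht, Complex.norm_real, Complex.sub_re, hs,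
      Complex.one_re, Real.norm_of_nonneg (inv_nonneg.2 (by linarith [hF1 t ht]))]
    exact rpow_mul_inv_le_mellinMajorant ht (hF1 t ht) (hFT t)
  -- This weighted L¹ distance bounds the difference of the Mellin transforms at every `s` of the
  -- line at once.
  have key : Tendsto (fun N => ∫ t in Set.Ioi 0, t ^ (a - 1) * |((p N).eval t)⁻¹ - (F t)⁻¹|)
      atTop (𝓝 0) := by
    have hr : AEStronglyMeasurable (fun t : ℝ => t ^ (a - 1)) (volume.restrict (Set.Ioi 0)) :=
      (measurable_id.pow_const _).aestronglyMeasurable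
    have := tendsto_integral_filter_of_dominated_convergence
      (μ := volume.restrict (Set.Ioi 0)) (l := atTop)
      (F := fun N t => t ^ (a - 1) * |((p N).eval t)⁻¹ - (F t)⁻¹|) (f := fun _ => (0 : ℝ))
      (fun t => mellinMajorant a T m t) (.of_forall fun N => ?_) ?_ hDint ?_
    · simpa using this
    · exact hr.mul (((hpmeas N).aestronglyMeasurable.sub hFmeas).norm)
    · filter_upwards [hp1, hpT] with N h1 h2
      refine (ae_restrict_iff' measurableSet_Ioi).2 (.of_forall fun t (ht : 0 < t) => ?_)
      have ht' := Real.rpow_pos_of_pos ht (a - 1)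
      rw [Real.norm_of_nonneg (by positivity)]
      have hA := rpow_mul_inv_le_mellinMajorant (a := a) ht (h1 t ht) (h2 t)
      have hB := rpow_mul_inv_le_mellinMajorant (a := a) ht (hF1 t ht) (hFT t)
      have hA0 : 0 ≤ ((p N).eval t)⁻¹ := inv_nonneg.2 (by linarith [h1 t ht])
      have hB0 : 0 ≤ (F t)⁻¹ := inv_nonneg.2 (by linarith [hF1 t ht])
      -- Both reciprocals are nonnegative, so their difference is at most the larger one and the
      -- majorant needs no factor 2.
      rcases abs_cases (((p N).eval t)⁻¹ - (F t)⁻¹) with ⟨h, _⟩ | ⟨h, _⟩ <;> rw [h] <;> nlinarith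
    · refine (ae_restrict_iff' measurableSet_Ioi).2 (.of_forall fun t (ht : 0 < t) => ?_)
      have := (((hFlim t ht).sub_const (F t)⁻¹).abs).const_mul (t ^ (a - 1))
      simpa using this
  rw [Metric.tendstoUniformlyOn_iff]
  intro ε hε
  filter_upwards [key.eventually_lt_const hε, hp1, hpT] with N hN h1 h2 s hs
  have hs' : s.re = a := hs
  have hconvN := mellinConvergent_inv (f := fun t => (p N).eval t) ha hm hT0
    (hpmeas N).aestronglyMeasurable h1 h2 hs'
  rw [dist_comm, dist_eq_norm]
  refine lt_of_le_of_lt ?_ hN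
  rw [mellin, mellin, ← integral_sub hconvN (hconvF s hs')]
  refine (norm_integral_le_integral_norm _).trans_eq ?_
  refine setIntegral_congr_fun measurableSet_Ioi fun t (ht : 0 < t) => ?_
  simp only
  rw [← smul_sub, norm_smul, Complex.norm_cpow_eq_rpow_re_of_pos ht, ← Complex.ofReal_sub,
    Complex.norm_real, Complex.sub_re, hs', Complex.one_re, Real.norm_eq_abs]

/-! ### Lagrange interpolation and the generating function of a B-spline -/

theorem eval_eq_eval_knotPoly_mul_sum {Ω : Finset ℝ} {f : ℝ[X]} (hf : f.degree < Ω.card) {x : ℝ}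
    (hx : x ∉ Ω) : f.eval x = (knotPoly Ω).eval x *
      ∑ v ∈ Ω, f.eval v / ((x - v) * (derivative (knotPoly Ω)).eval v) := by
  have h : knotPoly Ω = Lagrange.nodal Ω id := by simp [knotPoly, Lagrange.nodal_eq]
  conv_lhs => rw [Lagrange.eq_interpolate (s := Ω) (v := id) (Set.injOn_id _) hf]
  rw [Lagrange.eval_interpolate_not_at_node, h]
  · congr 1
    refine Finset.sum_congr rfl fun v hv => ?_
    rw [Lagrange.nodalWeight_eq_eval_derivative_nodal hv, id, div_eq_mul_inv, mul_inv]
    ring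
  · rintro v hv rfl
    exact hx hv

theorem eval_derivative_knotPoly_ne_zero {Ω : Finset ℝ} {v : ℝ} (hv : v ∈ Ω) :
    (derivative (knotPoly Ω)).eval v ≠ 0 := by
  have h : knotPoly Ω = Lagrange.nodal Ω id := by simp [knotPoly, Lagrange.nodal_eq]
  have := Lagrange.nodalWeight_ne_zero (v := id) (Set.injOn_id _) hv
  rw [Lagrange.nodalWeight_eq_eval_derivative_nodal hv, ← h] at this
  simpa using this

/-- A divided difference of order N + 1 kills polynomials of degree N. Interpolating `(X + 1) * (X -
t) ^ N` at its root -1, which is not a knot, gives 0 on one side, while the factor `v + 1` cancels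
the denominator on the other. -/
theorem sum_pow_div_derivative_eq_zero {Ω : Finset ℝ} {N : ℕ} (hcard : Ω.card = N + 2)
    (hΩ : ∀ v ∈ Ω, 0 ≤ v) (t : ℝ) :
    ∑ v ∈ Ω, (v - t) ^ N / (derivative (knotPoly Ω)).eval v = 0 := by
  have hx : (-1 : ℝ) ∉ Ω := fun h => by linarith [hΩ _ h]
  have h := eval_eq_eval_knotPoly_mul_sum (Ω := Ω) (f := (X - C (-1)) * (X - C t) ^ N) ?_ hx
  · have hW : (knotPoly Ω).eval (-1) ≠ 0 := by
      rw [knotPoly, eval_prod, Finset.prod_ne_zero_iff]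
      intro v hv
      simp only [eval_sub, eval_X, eval_C]
      linarith [hΩ v hv]
    simp only [eval_mul, eval_sub, eval_X, eval_C, sub_self, zero_mul, eval_pow] at h
    have h' := (mul_eq_zero.1 h.symm).resolve_left hW
    rw [← neg_eq_zero, ← Finset.sum_neg_distrib, ← h']
    refine Finset.sum_congr rfl fun v hv => ?_
    have h1 := eval_derivative_knotPoly_ne_zero hv
    have h2 : (-1 : ℝ) - v ≠ 0 := by linarith [hΩ v hv]
    field_simp
    ring
  · refine lt_of_le_of_lt degree_le_natDegree ?_
    rw [natDegree_mul (X_sub_C_ne_zero _) (pow_ne_zero _ (X_sub_C_ne_zero _)), natDegree_pow,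
      natDegree_X_sub_C, natDegree_X_sub_C, hcard]
    exact_mod_cast (by omega : 1 + N * 1 < N + 2)

theorem continuous_bSpline (N : ℕ) (Ω : Finset ℝ) : Continuous (bSpline N Ω) := by
  unfold bSpline
  fun_prop

/-- The B-spline with nonnegative knots vanishes to order `N` at the simple knot `0`. -/
theorem exists_abs_bSpline_le {Ω : Finset ℝ} {N : ℕ} (hN : 1 ≤ N) (hcard : Ω.card = N + 2)
    (hΩ : ∀ v ∈ Ω, 0 ≤ v) (h0 : (0 : ℝ) ∈ Ω) :
    ∃ C, ∀ t, 0 < t → |bSpline N Ω t| ≤ C * t ^ N := by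
  -- Below the least positive knot `m`, every truncated power except that of the knot 0 is a genuine
  -- power. The full sum of powers vanishes, so only a multiple of `t ^ N` is left. Beyond `m` the
  -- spline is bounded and `1 ≤ t ^ N / m ^ N`.
  obtain ⟨m, hm0, hm⟩ : ∃ m : ℝ, 0 < m ∧ ∀ v ∈ Ω.erase 0, m ≤ v := by
    have hne : (Ω.erase 0).Nonempty := by
      rw [← Finset.card_pos, Finset.card_erase_of_mem h0]; omega
    refine ⟨(Ω.erase 0).min' hne, ?_, fun v hv => Finset.min'_le _ _ hv⟩
    have := Finset.min'_mem _ hne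
    exact lt_of_le_of_ne (hΩ _ (Finset.mem_of_mem_erase this)) (Finset.ne_of_mem_erase this).symm
  set W := fun v => (derivative (knotPoly Ω)).eval v
  set C₁ : ℝ := (N + 1) / |W 0|
  set C₂ : ℝ := (N + 1) * ∑ v ∈ Ω, v ^ N / |W v|
  have hC₁ : 0 ≤ C₁ := by positivity
  have hC₂ : 0 ≤ C₂ := by
    refine mul_nonneg (by positivity) (Finset.sum_nonneg fun v hv => ?_)
    have := hΩ v hv
    positivity
  refine ⟨C₁ + C₂ / m ^ N, fun t ht => ?_⟩
  have hN1 : (0 : ℝ) ≤ N + 1 := by positivity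
  rcases le_total t m with h | h
  · have key : bSpline N Ω t = (N + 1) * -((0 - t) ^ N / W 0) := by
      have hs := sum_pow_div_derivative_eq_zero hcard hΩ t
      rw [← Finset.add_sum_erase _ _ h0] at hs
      rw [bSpline, ← Finset.add_sum_erase _ _ h0, max_eq_right (by linarith), zero_pow (by omega),
        zero_div, zero_add]
      congr 1
      rw [← eq_neg_of_add_eq_zero_right hs]
      refine Finset.sum_congr rfl fun v hv => ?_
      rw [max_eq_left (by linarith [hm v hv])]
    have : |bSpline N Ω t| = C₁ * t ^ N := by
      rw [key, abs_mul, abs_neg, abs_div, abs_pow, zero_sub, abs_neg, abs_of_pos ht,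
        abs_of_nonneg hN1]
      ring
    rw [this]
    have : 0 ≤ C₂ / m ^ N := by positivity
    gcongr
    linarith
  · have : |bSpline N Ω t| ≤ C₂ := by
      rw [bSpline, abs_mul, abs_of_nonneg hN1]
      refine mul_le_mul_of_nonneg_left ?_ hN1
      refine (Finset.abs_sum_le_sum_abs _ _).trans (Finset.sum_le_sum fun v hv => ?_)
      have hv0 := hΩ v hv
      rw [abs_div, abs_pow, abs_of_nonneg (le_max_right _ _)]
      gcongr
      exact max_le (by linarith) hv0
    have h2 : 1 ≤ t ^ N / m ^ N := by
      rw [← div_pow]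
      exact one_le_pow₀ ((one_le_div hm0).2 h)
    calc |bSpline N Ω t| ≤ C₂ * 1 := by linarith
      _ ≤ C₂ * (t ^ N / m ^ N) := by gcongr
      _ ≤ C₁ * t ^ N + C₂ * (t ^ N / m ^ N) := le_add_of_nonneg_left (by positivity)
      _ = _ := by ring

/-- The derivative of (v - t)/(t + w) is -(v + w)/(t + w)², so the exponents N and N + 2 make the
integrand an exact derivative of a multiple of ((v - t)/(t + w))^(N+1). -/
theorem integral_truncated_pow_div {N : ℕ} (hN : 1 ≤ N) {v M w : ℝ} (hv : 0 ≤ v) (hvM : v ≤ M)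
    (hw : 0 < w) : ∫ t in (0 : ℝ)..M, max (v - t) 0 ^ N / (t + w) ^ (N + 2) =
      v ^ (N + 1) / (w ^ (N + 1) * (v + w) * (N + 1)) := by
  have hcont : ContinuousOn (fun t => max (v - t) 0 ^ N / (t + w) ^ (N + 2)) (Set.Icc 0 M) := by
    refine ContinuousOn.div (by fun_prop) (by fun_prop) fun t ht => ?_
    have : 0 < t + w := by linarith [ht.1]
    positivity
  have hi : ∀ a b, 0 ≤ a → a ≤ b → b ≤ M → IntervalIntegrable
      (fun t => max (v - t) 0 ^ N / (t + w) ^ (N + 2)) volume a b := fun a b h0 hab hb =>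
    (hcont.mono (by rw [Set.uIcc_of_le hab]; exact Set.Icc_subset_Icc h0 hb)).intervalIntegrable
  rw [← intervalIntegral.integral_add_adjacent_intervals (hi 0 v le_rfl hv hvM)
    (hi v M hv hvM le_rfl)]
  have h2 : ∫ t in v..M, max (v - t) 0 ^ N / (t + w) ^ (N + 2) = 0 := by
    rw [intervalIntegral.integral_congr (g := fun _ => (0 : ℝ))]
    · simp
    · intro t ht
      rw [Set.uIcc_of_le hvM] at ht
      simp only
      rw [max_eq_right (by linarith [ht.1]), zero_pow (by omega), zero_div]
  have h1 : ∫ t in (0 : ℝ)..v, max (v - t) 0 ^ N / (t + w) ^ (N + 2) =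
      -((v - v) / (v + w)) ^ (N + 1) / ((v + w) * (N + 1)) -
      -((v - 0) / (0 + w)) ^ (N + 1) / ((v + w) * (N + 1)) := by
    refine intervalIntegral.integral_eq_sub_of_hasDerivAt
      (f := fun t => -((v - t) / (t + w)) ^ (N + 1) / ((v + w) * (N + 1))) (fun t ht => ?_)
      (hi 0 v le_rfl hv hvM)
    rw [Set.uIcc_of_le hv] at ht
    have htw : t + w ≠ 0 := by linarith [ht.1]
    have hvw : v + w ≠ 0 := by linarith
    have hN0 : (N : ℝ) + 1 ≠ 0 := by positivity
    have hd := (((((hasDerivAt_id t).const_sub v).div ((hasDerivAt_id t).add_const w) htw).pow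
      (N + 1)).neg).div_const ((v + w) * (N + 1))
    refine hd.congr_deriv ?_
    simp only [id, Nat.add_sub_cancel, Pi.div_apply]
    rw [max_eq_left (by linarith [ht.2])]
    push_cast
    rw [div_pow]
    field_simp
    ring
  rw [h1, h2, sub_self, zero_div, zero_pow (by omega), zero_add, sub_zero, div_pow]
  have hvw : v + w ≠ 0 := by linarith
  field_simp
  ring

/-- The generating function of a B-spline. -/
theorem integral_bSpline_div {Ω : Finset ℝ} {N : ℕ} (hN : 1 ≤ N) (hcard : Ω.card = N + 2)
    (hΩ : ∀ v ∈ Ω, 0 ≤ v) {M : ℝ} (hM : 0 ≤ M) (hΩM : ∀ v ∈ Ω, v ≤ M) {w : ℝ} (hw : 0 < w) :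
    ∫ t in (0 : ℝ)..M, bSpline N Ω t / (t + w) ^ (N + 2) = (∏ v ∈ Ω, (v + w))⁻¹ := by
  have hxΩ : -w ∉ Ω := fun h => by linarith [hΩ _ h]
  -- Interpolating `X ^ (N + 1)` at `-w` sums the contributions of the knots; the resulting `w ^ (N
  -- + 1)` cancels the one in the denominator of each single integral.
  have hlag := eval_eq_eval_knotPoly_mul_sum (Ω := Ω) (f := X ^ (N + 1)) (by
    rw [degree_X_pow, hcard]; exact_mod_cast Nat.lt_succ_self _) hxΩ
  have hW : (knotPoly Ω).eval (-w) = (-1) ^ (N + 2) * ∏ v ∈ Ω, (v + w) := by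
    rw [knotPoly, eval_prod, ← hcard, ← Finset.prod_const, ← Finset.prod_mul_distrib]
    refine Finset.prod_congr rfl fun v _ => ?_
    simp
    ring
  have hprod : ∏ v ∈ Ω, (v + w) ≠ 0 :=
    Finset.prod_ne_zero_iff.2 fun v hv => by linarith [hΩ v hv]
  have hsum : ∑ v ∈ Ω, v ^ (N + 1) / ((v + w) * (derivative (knotPoly Ω)).eval v) =
      w ^ (N + 1) / ∏ v ∈ Ω, (v + w) := by
    rw [eq_div_iff hprod]
    have h1 : ∑ v ∈ Ω, v ^ (N + 1) / ((v + w) * (derivative (knotPoly Ω)).eval v) =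
        -∑ v ∈ Ω, (X ^ (N + 1) : ℝ[X]).eval v /
          ((-w - v) * (derivative (knotPoly Ω)).eval v) := by
      rw [← Finset.sum_neg_distrib]
      refine Finset.sum_congr rfl fun v hv => ?_
      rw [eval_pow, eval_X, ← div_neg]
      ring_nf
    rw [hW, eval_pow, eval_X, neg_pow] at hlag
    rw [h1]
    have h3 : ((-1 : ℝ) ^ (N + 1)) * (-1) ^ (N + 1) = 1 := by
      rw [← mul_pow]; simp
    set S := ∑ v ∈ Ω, (X ^ (N + 1) : ℝ[X]).eval v /
          ((-w - v) * (derivative (knotPoly Ω)).eval v)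
    have h4 : (-1 : ℝ) ^ (N + 2) = -(-1) ^ (N + 1) := by rw [pow_succ]; ring
    rw [h4] at hlag
    linear_combination -(-1 : ℝ) ^ (N + 1) * hlag + (w ^ (N + 1) + S * ∏ v ∈ Ω, (v + w)) * h3
  have hterm : ∀ v ∈ Ω, IntervalIntegrable (fun t => (N + 1) /
      (derivative (knotPoly Ω)).eval v * (max (v - t) 0 ^ N / (t + w) ^ (N + 2))) volume 0 M := by
    intro v _
    refine ContinuousOn.intervalIntegrable ?_
    refine ContinuousOn.mul (by fun_prop) (ContinuousOn.div (by fun_prop) (by fun_prop) fun t ht => ?_)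
    rw [Set.uIcc_of_le hM] at ht
    have : 0 < t + w := by linarith [ht.1]
    positivity
  have hexp : ∀ t, bSpline N Ω t / (t + w) ^ (N + 2) = ∑ v ∈ Ω, (N + 1) /
      (derivative (knotPoly Ω)).eval v * (max (v - t) 0 ^ N / (t + w) ^ (N + 2)) := by
    intro t
    rw [bSpline, Finset.mul_sum, Finset.sum_div]
    refine Finset.sum_congr rfl fun v _ => ?_
    ring
  simp only [hexp]
  rw [intervalIntegral.integral_finsetSum hterm]
  calc _ = ∑ v ∈ Ω, (w ^ (N + 1))⁻¹ *
        (v ^ (N + 1) / ((v + w) * (derivative (knotPoly Ω)).eval v)) := by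
        refine Finset.sum_congr rfl fun v hv => ?_
        rw [intervalIntegral.integral_const_mul, integral_truncated_pow_div hN (hΩ v hv)
          (hΩM v hv) hw]
        have h1 := eval_derivative_knotPoly_ne_zero hv
        have h2 : v + w ≠ 0 := by linarith [hΩ v hv]
        have hN0 : (N : ℝ) + 1 ≠ 0 := by positivity
        field_simp
    _ = _ := by
        rw [← Finset.mul_sum, hsum]
        field_simp

/-! ### The Mellin transform of the associated B-spline -/

theorem bSplineStar_eq_of_pos {N : ℕ} {Ω : Finset ℝ} {t : ℝ} (ht : 0 < t) :
    bSplineStar N Ω t = (t ^ N)⁻¹ * bSpline N Ω t := by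
  rw [bSplineStar, if_neg ht.ne']

/-- The order of vanishing at 0 makes B_N^* bounded, so only t^(σ-1) matters; the value assigned at
t = 0 plays no role. -/
theorem intervalIntegrable_bSplineStar_mul_cpow {Ω : Finset ℝ} {N : ℕ} (hN : 1 ≤ N)
    (hcard : Ω.card = N + 2) (hΩ : ∀ v ∈ Ω, 0 ≤ v) (h0 : (0 : ℝ) ∈ Ω) {M : ℝ} (hM : 0 ≤ M)
    {σ : ℂ} (hσ : 0 < σ.re) : IntervalIntegrable
      (fun t : ℝ => (bSplineStar N Ω t : ℂ) * (t : ℂ) ^ (σ - 1)) volume 0 M := by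
  obtain ⟨C, hC⟩ := exists_abs_bSpline_le hN hcard hΩ h0
  have h1 : IntervalIntegrable (fun t : ℝ => (t : ℂ) ^ (σ - 1)) volume 0 M :=
    intervalIntegral.intervalIntegrable_cpow' (by simpa using hσ)
  rw [intervalIntegrable_iff_integrableOn_Ioc_of_le hM] at h1 ⊢
  have h2 : IntegrableOn (fun t : ℝ => (((t ^ N)⁻¹ * bSpline N Ω t : ℝ) : ℂ) * (t : ℂ) ^ (σ - 1))
      (Set.Ioc 0 M) := by
    refine Integrable.bdd_mul (c := C) h1 ?_ ?_
    · have := (continuous_bSpline N Ω).measurable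
      exact (Complex.measurable_ofReal.comp
        (((measurable_id.pow_const N).inv).mul this)).aestronglyMeasurable
    · refine (ae_restrict_iff' measurableSet_Ioc).2 (.of_forall fun t ht => ?_)
      have ht0 : 0 < t ^ N := pow_pos ht.1 N
      rw [Complex.norm_real, Real.norm_eq_abs, abs_mul, abs_of_pos (inv_pos.2 ht0),
        inv_mul_le_iff₀ ht0, mul_comm]
      exact hC t ht.1
  refine h2.congr_fun (fun t ht => ?_) measurableSet_Ioc
  simp only
  rw [bSplineStar_eq_of_pos ht.1]

theorem mellinConvergent_inv_one_add_pow {n : ℕ} {s : ℂ} (h0 : 0 < s.re) (hn : s.re < n) :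
    MellinConvergent (fun w : ℝ => ((((1 + w) ^ n)⁻¹ : ℝ) : ℂ)) s := by
  refine mellinConvergent_inv (f := fun w => (1 + w) ^ n) (T := 1) h0 hn one_pos ?_ ?_ ?_ rfl
  · exact (((measurable_const.add measurable_id).pow_const n).inv).aestronglyMeasurable
  · intro t ht
    exact one_le_pow₀ (by linarith)
  · intro t ht
    exact pow_le_pow_left₀ (by linarith) (by linarith) n

theorem mellin_inv_add_pow (n : ℕ) (s : ℂ) {t : ℝ} (ht : 0 < t) :
    mellin (fun w : ℝ => ((((t + w) ^ n)⁻¹ : ℝ) : ℂ)) s =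
      (t : ℂ) ^ (s - n) * mellin (fun w : ℝ => ((((1 + w) ^ n)⁻¹ : ℝ) : ℂ)) s := by
  have h := mellin_comp_mul_left (fun w : ℝ => ((((1 + w) ^ n)⁻¹ : ℝ) : ℂ)) s (inv_pos.2 ht)
  have h' : (fun w : ℝ => ((((t + w) ^ n)⁻¹ : ℝ) : ℂ)) = fun w : ℝ =>
      (((t ^ n)⁻¹ : ℝ) : ℂ) • ((((1 + t⁻¹ * w) ^ n)⁻¹ : ℝ) : ℂ) := by
    ext w
    rw [smul_eq_mul, ← Complex.ofReal_mul, ← mul_inv, ← mul_pow]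
    congr 4
    field_simp
  have htc : (t : ℂ) ≠ 0 := by exact_mod_cast ht.ne'
  have harg : (t : ℂ).arg ≠ Real.pi := by
    rw [Complex.arg_ofReal_of_nonneg ht.le]; exact Real.pi_pos.ne
  rw [h', mellin_const_smul, h, smul_eq_mul, smul_eq_mul, ← mul_assoc]
  congr 1
  rw [Complex.ofReal_inv, Complex.ofReal_inv, Complex.inv_cpow _ _ harg, Complex.cpow_neg, inv_inv,
    Complex.cpow_sub _ _ htc, Complex.cpow_natCast, Complex.ofReal_pow]
  ring

theorem integral_norm_mellin_integrand {n : ℕ} {s : ℂ} {t : ℝ} (ht : 0 < t) :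
    ∫ w in Set.Ioi (0 : ℝ), ‖(w : ℂ) ^ (s - 1) • ((((t + w) ^ n)⁻¹ : ℝ) : ℂ)‖ =
      t ^ (s.re - n) * ∫ w in Set.Ioi (0 : ℝ), w ^ (s.re - 1) * ((1 + w) ^ n)⁻¹ := by
  have hn : ∀ w ∈ Set.Ioi (0 : ℝ), ‖(w : ℂ) ^ (s - 1) • ((((t + w) ^ n)⁻¹ : ℝ) : ℂ)‖ =
      w ^ (s.re - 1) * ((t + w) ^ n)⁻¹ := by
    intro w (hw : 0 < w)
    rw [norm_smul, Complex.norm_cpow_eq_rpow_re_of_pos hw, Complex.norm_real, Complex.sub_re,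
      Complex.one_re, Real.norm_of_nonneg (by positivity)]
  rw [setIntegral_congr_fun measurableSet_Ioi hn]
  have h := integral_comp_mul_left_Ioi (fun w => w ^ (s.re - 1) * ((t + w) ^ n)⁻¹) 0 ht
  rw [mul_zero, smul_eq_mul, eq_inv_mul_iff_mul_eq₀ ht.ne'] at h
  rw [← h, ← integral_const_mul, ← integral_const_mul]
  refine setIntegral_congr_fun measurableSet_Ioi fun w (hw : 0 < w) => ?_
  rw [Real.mul_rpow ht.le hw.le, Real.rpow_sub ht, Real.rpow_sub ht, Real.rpow_natCast,
    Real.rpow_one, show t + t * w = t * (1 + w) by ring, mul_pow]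
  have : 0 < 1 + w := by linarith
  field_simp

/-- The Mellin transform of an associated B-spline with nonnegative knots, up to the Mellin
transform of `(1 + w) ^ (-(N + 2))`, is the Mellin transform of the reciprocal of a product. -/
theorem integral_bSplineStar_mul_mellin {Ω : Finset ℝ} {N : ℕ} (hN : 1 ≤ N)
    (hcard : Ω.card = N + 2) (hΩ : ∀ v ∈ Ω, 0 ≤ v) (h0 : (0 : ℝ) ∈ Ω) {M : ℝ} (hM : 0 ≤ M)
    (hΩM : ∀ v ∈ Ω, v ≤ M) {σ : ℂ} (hσ : 0 < σ.re) (hσN : σ.re < N + 1) :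
    (∫ t in (0 : ℝ)..M, (bSplineStar N Ω t : ℂ) * (t : ℂ) ^ (σ - 1)) *
      mellin (fun w : ℝ => ((((1 + w) ^ (N + 2))⁻¹ : ℝ) : ℂ)) (σ + 1) =
    mellin (fun w : ℝ => (((∏ v ∈ Ω.erase 0, (v + w))⁻¹ : ℝ) : ℂ)) σ := by
  set G := mellin (fun w : ℝ => ((((1 + w) ^ (N + 2))⁻¹ : ℝ) : ℂ)) (σ + 1)
  -- The Mellin variable is `σ + 1` because one power of `w` will be cancelled by the knot 0.
  set f : ℝ → ℝ → ℂ := fun t w => (bSpline N Ω t : ℂ) *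
    ((w : ℂ) ^ (σ + 1 - 1) • ((((t + w) ^ (N + 2))⁻¹ : ℝ) : ℂ)) with hf
  have hcpow : ∀ t : ℝ, 0 < t → (bSpline N Ω t : ℂ) * (t : ℂ) ^ (σ + 1 - ((N + 2 : ℕ) : ℂ)) =
      (bSplineStar N Ω t : ℂ) * (t : ℂ) ^ (σ - 1) := by
    intro t ht
    have htc : (t : ℂ) ≠ 0 := by exact_mod_cast ht.ne'
    rw [bSplineStar_eq_of_pos ht,
      show σ + 1 - ((N + 2 : ℕ) : ℂ) = σ - 1 - (N : ℂ) by push_cast; ring,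
      Complex.cpow_sub _ _ htc, Complex.cpow_natCast]
    push_cast
    ring
  have hint := (intervalIntegrable_bSplineStar_mul_cpow hN hcard hΩ h0 hM hσ)
  rw [intervalIntegrable_iff_integrableOn_Ioc_of_le hM] at hint
  have hσ1 : (σ + 1).re = σ.re + 1 := by simp
  have hGconv : MellinConvergent (fun w : ℝ => ((((1 + w) ^ (N + 2))⁻¹ : ℝ) : ℂ)) (σ + 1) :=
    mellinConvergent_inv_one_add_pow (by rw [hσ1]; linarith) (by rw [hσ1]; push_cast; linarith)
  have hconv : ∀ t : ℝ, 0 < t →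
      MellinConvergent (fun w : ℝ => ((((t + w) ^ (N + 2))⁻¹ : ℝ) : ℂ)) (σ + 1) := by
    intro t ht
    have h := ((MellinConvergent.comp_mul_left (inv_pos.2 ht)).2 hGconv).const_smul
      (((t ^ (N + 2))⁻¹ : ℝ) : ℂ)
    refine h.congr (.of_forall fun w => ?_)
    simp only
    congr 1
    rw [smul_eq_mul, ← Complex.ofReal_mul, ← mul_inv, ← mul_pow]
    congr 3
    field_simp
  have hfmeas : Measurable (Function.uncurry f) := by
    have hB := (continuous_bSpline N Ω).measurable
    have h1 : Measurable fun x : ℝ × ℝ => (bSpline N Ω x.1 : ℂ) :=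
      Complex.measurable_ofReal.comp (hB.comp measurable_fst)
    have h2 : Measurable fun x : ℝ × ℝ => (x.2 : ℂ) ^ (σ + 1 - 1) :=
      (Complex.measurable_ofReal.comp measurable_snd).pow_const _
    have h3 : Measurable fun x : ℝ × ℝ => ((((x.1 + x.2) ^ (N + 2))⁻¹ : ℝ) : ℂ) :=
      Complex.measurable_ofReal.comp (((measurable_fst.add measurable_snd).pow_const _).inv)
    exact h1.mul (h2.smul h3)
  -- Fubini's hypothesis: by scaling, the `w`-integral of the norm is a constant times the norm of
  -- `B_N^*(t) t^(σ-1)`, which is integrable.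
  have hfint : Integrable (Function.uncurry f)
      ((volume.restrict (Set.Ioc 0 M)).prod (volume.restrict (Set.Ioi 0))) := by
    rw [integrable_prod_iff hfmeas.aestronglyMeasurable]
    refine ⟨(ae_restrict_iff' measurableSet_Ioc).2 (.of_forall fun t ht => ?_), ?_⟩
    · exact Integrable.const_mul (hconv t ht.1) (bSpline N Ω t : ℂ)
    · refine IntegrableOn.congr_fun (hint.norm.mul_const (∫ w in Set.Ioi (0 : ℝ),
        w ^ ((σ + 1).re - 1) * ((1 + w) ^ (N + 2))⁻¹)) (fun t ht => ?_) measurableSet_Ioc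
      simp only [Function.uncurry_apply_pair, hf]
      simp_rw [norm_mul (bSpline N Ω t : ℂ)]
      rw [integral_const_mul, integral_norm_mellin_integrand ht.1, ← mul_assoc, ← hcpow t ht.1,
        norm_mul, Complex.norm_cpow_eq_rpow_re_of_pos ht.1]
      congr 3
  have hL : ∀ t ∈ Set.Ioc 0 M, (bSplineStar N Ω t : ℂ) * (t : ℂ) ^ (σ - 1) * G =
      ∫ w in Set.Ioi (0 : ℝ), f t w := by
    intro t ht
    have h := mellin_inv_add_pow (N + 2) (σ + 1) ht.1
    rw [mellin] at h
    simp only [hf]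
    rw [integral_const_mul, h, ← hcpow t ht.1, mul_assoc]
  have hR : ∀ w ∈ Set.Ioi (0 : ℝ), ∫ t in Set.Ioc 0 M, f t w =
      (w : ℂ) ^ (σ - 1) • (((∏ v ∈ Ω.erase 0, (v + w))⁻¹ : ℝ) : ℂ) := by
    intro w (hw : 0 < w)
    have hwc : (w : ℂ) ≠ 0 := by exact_mod_cast hw.ne'
    have h1 : ∀ t, f t w = (w : ℂ) ^ σ * ((bSpline N Ω t / (t + w) ^ (N + 2) : ℝ) : ℂ) := by
      intro t
      simp only [hf, add_sub_cancel_right, smul_eq_mul]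
      push_cast
      ring
    simp only [h1]
    rw [integral_const_mul, integral_complex_ofReal, ← intervalIntegral.integral_of_le hM,
      integral_bSpline_div hN hcard hΩ hM hΩM hw, ← Finset.mul_prod_erase _ _ h0,
      Complex.cpow_sub _ _ hwc, Complex.cpow_one, zero_add, smul_eq_mul]
    push_cast
    field_simp
  rw [intervalIntegral.integral_of_le hM, ← integral_mul_const,
    setIntegral_congr_fun measurableSet_Ioc hL, integral_integral_swap hfint,
    setIntegral_congr_fun measurableSet_Ioi hR, mellin]

/-! ### The class of polynomials on the imaginary axis -/

theorem mem_roots_neg_of_parity {p : ℝ[X]} {d : ℕ} (hpar : p.comp (-X) = (-1) ^ d * p)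
    {x : ℝ} (hx : x ∈ p.roots.toFinset) : -x ∈ p.roots.toFinset := by
  rw [Multiset.mem_toFinset, mem_roots'] at hx ⊢
  refine ⟨hx.1, ?_⟩
  have h := congrArg (fun q => q.eval x) hpar
  have hx2 : p.eval x = 0 := hx.2
  simp only [eval_comp, eval_neg, eval_X, eval_mul, hx2, mul_zero] at h
  exact h

/-- Even and odd monic polynomials with simple real zeros, in terms of their positive zeros. -/
theorem card_posZeros_and_eq_prod {p : ℝ[X]} {d N : ℕ} (hd : d = 0 ∨ d = 1) (hmonic : p.Monic)
    (hdeg : p.natDegree = 2 * N + d) (hpar : p.comp (-X) = (-1) ^ d * p) (hsplit : p.Splits)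
    (hsimple : p.roots.Nodup) :
    (posZeros p).card = N ∧ p = X ^ d * ∏ x ∈ posZeros p, (X ^ 2 - C (x ^ 2)) := by
  classical
  set S := p.roots.toFinset with hS
  have hcard : S.card = 2 * N + d := by
    rw [hS, Multiset.toFinset_card_of_nodup hsimple, ← hdeg, hsplit.natDegree_eq_card_roots]
  have hprod : p = ∏ r ∈ S, (X - C r) := by
    conv_lhs => rw [hsplit.eq_prod_roots_of_monic hmonic]
    rw [hS, Finset.prod_eq_multiset_prod, Multiset.toFinset_val, hsimple.dedup]
  have hneg : (S.filter fun x => ¬ 0 < x).filter (fun x => x < 0) =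
      (posZeros p).image (fun x => -x) := by
    ext x
    simp only [posZeros, ← hS, Finset.mem_filter, Finset.mem_image]
    constructor
    · rintro ⟨⟨h1, _⟩, h2⟩
      exact ⟨-x, ⟨mem_roots_neg_of_parity hpar h1, by linarith⟩, neg_neg x⟩
    · rintro ⟨y, ⟨h1, h2⟩, rfl⟩
      exact ⟨⟨mem_roots_neg_of_parity hpar h1, by linarith⟩, by linarith⟩
  have hzero : (S.filter fun x => ¬ 0 < x).filter (fun x => ¬ x < 0) = S.filter (fun x => x = 0) := by
    ext x
    simp only [Finset.mem_filter, not_lt, and_assoc]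
    exact and_congr_right fun _ => ⟨fun h => le_antisymm h.1 h.2, fun h => by simp [h]⟩
  have hinj : Set.InjOn (fun x : ℝ => -x) (posZeros p) := neg_injective.injOn
  have hc1 := Finset.card_filter_add_card_filter_not (s := S) (fun x => 0 < x)
  have hc2 := Finset.card_filter_add_card_filter_not (s := S.filter fun x => ¬ 0 < x)
    (fun x => x < 0)
  rw [hneg, hzero, Finset.card_image_of_injOn hinj] at hc2
  have hc3 : (S.filter fun x => 0 < x).card = (posZeros p).card := rfl
  have hc4 : (S.filter (fun x => x = 0)).card ≤ 1 :=
    Finset.card_le_one.2 fun a ha b hb => by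
      rw [(Finset.mem_filter.1 ha).2, (Finset.mem_filter.1 hb).2]
  -- Negative and positive zeros are equally many, and at most one zero is 0; with 2N + d zeros and
  -- d ≤ 1, parity settles both counts.
  have hcN : (posZeros p).card = N := by omega
  have hcd : (S.filter (fun x => x = 0)).card = d := by omega
  refine ⟨hcN, ?_⟩
  conv_lhs => rw [hprod]
  rw [← Finset.prod_filter_mul_prod_filter_not S (fun x => 0 < x),
    ← Finset.prod_filter_mul_prod_filter_not (S.filter fun x => ¬ 0 < x) (fun x => x < 0),
    hneg, hzero, Finset.prod_image hinj]
  have hX : ∏ x ∈ S.filter (fun x => x = 0), (X - C x) = (X : ℝ[X]) ^ d := by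
    rw [← hcd, ← Finset.prod_const]
    refine Finset.prod_congr rfl fun x hx => ?_
    rw [(Finset.mem_filter.1 hx).2, C_0, sub_zero]
  rw [hX, ← mul_assoc, mul_comm, posZeros, ← Finset.prod_mul_distrib]
  congr 1
  refine Finset.prod_congr rfl fun x _ => ?_
  rw [C_neg, C_pow]
  ring

theorem pos_of_mem_posZeros {p : ℝ[X]} {x : ℝ} (hx : x ∈ posZeros p) : 0 < x :=
  (Finset.mem_filter.1 hx).2

theorem eval_zero_iterate_derivative_X_pow_mul {d : ℕ} (hd : d = 0 ∨ d = 1) (q : ℝ[X]) :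
    (derivative^[d] (X ^ d * q)).eval 0 = q.eval 0 := by
  rcases hd with rfl | rfl <;> simp

/-- The normalized polynomial in the class `𝒫_d` at the point `i √t`. -/
theorem normalized_eval_I_mul_sqrt {p : ℝ[X]} {d : ℕ} (hd : d = 0 ∨ d = 1) {S : Finset ℝ}
    (hS : ∀ x ∈ S, 0 < x) (hp : p = X ^ d * ∏ x ∈ S, (X ^ 2 - C (x ^ 2))) {b t : ℝ} (hb : 0 < b)
    (ht : 0 ≤ t) :
    (b : ℂ) ^ d * aeval (Complex.I * (Real.sqrt t : ℂ) / (b : ℂ)) p /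
      ((derivative^[d] p).eval 0 : ℝ) =
      Complex.I ^ d * ((Real.sqrt t ^ d * ∏ x ∈ S, (1 + (b ^ 2 * x ^ 2)⁻¹ * t) : ℝ) : ℂ) := by
  have hbc : (b : ℂ) ≠ 0 := by exact_mod_cast hb.ne'
  have hder : (derivative^[d] p).eval 0 = ∏ x ∈ S, (-(x ^ 2)) := by
    rw [hp, eval_zero_iterate_derivative_X_pow_mul hd, eval_prod]
    refine Finset.prod_congr rfl fun x _ => ?_
    simp
  have hsq : (Real.sqrt t : ℂ) ^ 2 = t := by exact_mod_cast Real.sq_sqrt ht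
  have hne : (∏ x ∈ S, (-((x : ℂ) ^ 2))) ≠ 0 := by
    refine Finset.prod_ne_zero_iff.2 fun x hx => neg_ne_zero.2 (pow_ne_zero _ ?_)
    exact_mod_cast (hS x hx).ne'
  rw [hder, hp]
  simp only [map_mul, map_pow, map_prod, map_sub, aeval_X, aeval_C, Complex.coe_algebraMap]
  push_cast
  rw [div_eq_iff hne, mul_assoc _ _ (∏ x ∈ S, (-((x : ℂ) ^ 2))), mul_assoc _ _ (∏ x ∈ S, _),
    ← Finset.prod_mul_distrib, div_pow, mul_pow]
  have : ∀ x ∈ S, (Complex.I * (Real.sqrt t : ℂ) / (b : ℂ)) ^ 2 - (x : ℂ) ^ 2 =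
      (1 + ((b : ℂ) ^ 2 * (x : ℂ) ^ 2)⁻¹ * t) * -(x : ℂ) ^ 2 := by
    intro x hx
    have hxc : (x : ℂ) ≠ 0 := by exact_mod_cast (hS x hx).ne'
    rw [div_pow, mul_pow, Complex.I_sq, hsq]
    field_simp
    ring
  rw [Finset.prod_congr rfl this]
  field_simp

/-- The function `h_d(√t) / √t ^ d`. -/
def limitFun (d : ℕ) (t : ℝ) : ℝ := hyp d (Real.sqrt t) / Real.sqrt t ^ d

theorem cos_I_mul_sub {d : ℕ} (hd : d = 0 ∨ d = 1) (x : ℝ) :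
    Complex.cos (Complex.I * (x : ℂ) - d * Real.pi / 2) = Complex.I ^ d * (hyp d x : ℂ) := by
  rcases hd with rfl | rfl
  · simp [hyp, mul_comm Complex.I, Complex.cos_mul_I]
  · simp [hyp, Complex.cos_sub_pi_div_two, mul_comm Complex.I, Complex.sin_mul_I]

theorem ClassP.card_and_eq_prod {d : ℕ} {β γ δ : ℕ → ℝ} {P : ℕ → ℝ[X]} (hP : ClassP d β γ δ P)
    (hd : d = 0 ∨ d = 1) {N : ℕ} (hN : 1 ≤ N) : (posZeros (P N)).card = N ∧
      P N = X ^ d * ∏ x ∈ posZeros (P N), (X ^ 2 - C (x ^ 2)) :=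
  card_posZeros_and_eq_prod hd (hP.monic N hN) (hP.natDegree_eq N hN) (hP.parity N hN)
    (hP.splits N hN) (hP.simple N hN)

/-- The asymptotic bound is used at `z = i√t`, which is admissible once `√t ≤ γ N`. Polynomial and
cosine both carry the factor `I ^ d`, which disappears in the norm. -/
theorem ClassP.tendsto_prod {d : ℕ} {β γ δ : ℕ → ℝ} {P : ℕ → ℝ[X]} (hP : ClassP d β γ δ P)
    (hd : d = 0 ∨ d = 1) {t : ℝ} (ht : 0 < t) :
    Tendsto (fun N => ∏ x ∈ posZeros (P N), (1 + (β N ^ 2 * x ^ 2)⁻¹ * t)) atTop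
      (𝓝 (limitFun d t)) := by
  obtain ⟨K, hK, hasymp⟩ := hP.asymp
  have hs : 0 < Real.sqrt t := Real.sqrt_pos.2 ht
  have hδ : Tendsto δ atTop (𝓝 0) := by
    exact hP.δ_lim.inv_tendsto_atTop.congr fun N => inv_inv _
  have hz : ‖Complex.I * (Real.sqrt t : ℂ)‖ = Real.sqrt t := by
    rw [norm_mul, Complex.norm_I, one_mul, Complex.norm_real, Real.norm_of_nonneg hs.le]
  have hmain : Tendsto (fun N => Real.sqrt t ^ d *
      ∏ x ∈ posZeros (P N), (1 + (β N ^ 2 * x ^ 2)⁻¹ * t)) atTop (𝓝 (hyp d (Real.sqrt t))) := by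
    rw [tendsto_iff_norm_sub_tendsto_zero]
    have hbound : Tendsto (fun N => K * (δ N * min (Real.sqrt t ^ 2) 1 * hyp d (Real.sqrt t)))
        atTop (𝓝 0) := by
      simpa using ((hδ.mul_const _).mul_const _).const_mul K
    refine squeeze_zero' (.of_forall fun N => norm_nonneg _) ?_ hbound
    filter_upwards [eventually_ge_atTop 1, hP.γ_lim.eventually_ge_atTop (Real.sqrt t)] with N hN hγ
    have h := hasymp N hN (Complex.I * (Real.sqrt t : ℂ)) (by rw [hz]; exact hγ)
    rw [hz, cos_I_mul_sub hd, normalized_eval_I_mul_sqrt hd (fun x => pos_of_mem_posZeros)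
      (hP.card_and_eq_prod hd hN).2 (hP.β_pos N hN) ht.le, ← mul_sub, norm_mul, norm_pow,
      Complex.norm_I, one_pow, one_mul, ← Complex.ofReal_sub, Complex.norm_real] at h
    exact h
  have := hmain.div_const (Real.sqrt t ^ d)
  refine this.congr fun N => ?_
  field_simp

/-! ### Growth, nonnegative coefficients and a quotient of uniform limits -/

theorem le_limitFun_sq {d : ℕ} (hd : d = 0 ∨ d = 1) {x : ℝ} (hx : 1 ≤ x) :
    (Real.exp x - 1) / (2 * x) ≤ limitFun d (x ^ 2) := by
  have h0 : 0 < x := by linarith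
  rw [limitFun, Real.sqrt_sq h0.le]
  have he : Real.exp (-x) ≤ 1 := Real.exp_le_one_iff.2 (by linarith)
  have he0 := Real.exp_pos (-x)
  have he1 := Real.one_le_exp h0.le
  rcases hd with rfl | rfl
  · simp only [hyp, if_true, pow_zero, div_one, Real.cosh_eq]
    rw [div_le_div_iff₀ (by positivity) two_pos]
    nlinarith
  · simp only [hyp, one_ne_zero, if_false, pow_one, Real.sinh_eq, div_div]
    gcongr

theorem exists_mul_pow_le_limitFun {d : ℕ} (hd : d = 0 ∨ d = 1) (m : ℕ) (c : ℝ) :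
    ∃ T, 1 ≤ T ∧ c * T ^ m ≤ limitFun d T := by
  -- With `T = x ^ 2`, the exponent covers `T ^ m = x ^ (2 * m)` and the denominator `2 * x` of the
  -- lower bound; the 1 in `2 * c + 1` covers the `-1` there.
  have h := Real.tendsto_exp_div_pow_atTop (2 * m + 1)
  obtain ⟨x, hx, hxc⟩ := ((eventually_ge_atTop (1 : ℝ)).and
    (h.eventually_ge_atTop (2 * c + 1))).exists
  refine ⟨x ^ 2, one_le_pow₀ hx, le_trans ?_ (le_limitFun_sq hd hx)⟩
  have h0 : 0 < x := by linarith
  rw [le_div_iff₀ (by positivity)] at hxc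
  rw [le_div_iff₀ (by positivity), ← pow_mul]
  have h1 : 1 ≤ x ^ (2 * m + 1) := one_le_pow₀ hx
  have h2 : c * x ^ (2 * m) * (2 * x) = 2 * c * x ^ (2 * m + 1) := by ring
  rw [h2]
  linarith

theorem exists_mul_pow_le_exp (m : ℕ) (c : ℝ) : ∃ T, 1 ≤ T ∧ c * T ^ m ≤ Real.exp T := by
  obtain ⟨x, hx, hxc⟩ := ((eventually_ge_atTop (1 : ℝ)).and
    ((Real.tendsto_exp_div_pow_atTop m).eventually_ge_atTop c)).exists
  exact ⟨x, hx, (le_div_iff₀ (by positivity)).1 hxc⟩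

theorem coeff_prod_one_add_C_mul_X {ι : Type*} (s : Finset ι) {c : ι → ℝ}
    (hc : ∀ i ∈ s, 0 ≤ c i) :
    (∏ i ∈ s, (1 + C (c i) * X)).coeff 0 = 1 ∧ ∀ k, 0 ≤ (∏ i ∈ s, (1 + C (c i) * X)).coeff k := by
  classical
  constructor
  · rw [coeff_zero_eq_eval_zero, eval_prod]
    simp
  · induction s using Finset.induction_on with
    | empty =>
      intro k
      rw [Finset.prod_empty, coeff_one]
      split_ifs <;> norm_num
    | insert i s hi ih =>
      intro k
      have ih' := ih fun j hj => hc j (Finset.mem_insert_of_mem hj)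
      have hci := hc i (Finset.mem_insert_self i s)
      rw [Finset.prod_insert hi, add_mul, one_mul, coeff_add, mul_assoc, coeff_C_mul]
      refine add_nonneg (ih' k) (mul_nonneg hci ?_)
      cases k with
      | zero => simp
      | succ k => rw [coeff_X_mul]; exact ih' k

/-- Since `g` is bounded away from 0, so is `G N` eventually, and b = I/G. Then l - g b = (l - I) -
(g - G) I/G, where both terms are uniformly small. -/
theorem tendstoUniformlyOn_mul_of_mul_eq {α : Type*} {K : Set α} {g l : α → ℂ}
    {b G I : ℕ → α → ℂ} (hG : TendstoUniformlyOn G g atTop K) (hI : TendstoUniformlyOn I l atTop K)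
    {m : ℝ} (hm : 0 < m) (hg : ∀ s ∈ K, m ≤ ‖g s‖) {M : ℝ} (hl : ∀ s ∈ K, ‖l s‖ ≤ M)
    (hb : ∀ᶠ N in atTop, ∀ s ∈ K, b N s * G N s = I N s) :
    TendstoUniformlyOn (fun N s => g s * b N s) l atTop K := by
  rw [Metric.tendstoUniformlyOn_iff] at hG hI ⊢
  intro ε hε
  set M' := |M| + 1
  have hM' : 0 < M' := by positivity
  -- `m / 2` keeps `‖G N s‖ ≥ m / 2`, the 1 keeps `‖I N s‖ ≤ M'`, and `ε * m / (4 * M')` then makes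
  -- the second term at most `ε / 2`.
  filter_upwards [hb, hG (min (m / 2) (ε * m / (4 * M'))) (by positivity),
    hI (min 1 (ε / 2)) (by positivity)] with N h1 h2 h3 s hs
  have h2' := lt_min_iff.1 (h2 s hs)
  have h3' := lt_min_iff.1 (h3 s hs)
  rw [dist_eq_norm] at h2' h3'
  have hGn : m / 2 ≤ ‖G N s‖ := by
    have := norm_sub_norm_le (g s) (G N s)
    linarith [hg s hs, h2'.1]
  have hGp : 0 < ‖G N s‖ := by linarith
  have hG0 : G N s ≠ 0 := norm_pos_iff.1 hGp
  have hIn : ‖I N s‖ ≤ M' := by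
    have := norm_sub_norm_le (I N s) (l s)
    rw [norm_sub_rev] at this
    have := hl s hs
    have := le_abs_self M
    linarith [h3'.1]
  have hbs : b N s = I N s / G N s := by rw [eq_div_iff hG0, h1 s hs]
  have hkey : l s - g s * b N s = (l s - I N s) - (g s - G N s) * I N s / G N s := by
    rw [hbs]
    field_simp
    ring
  rw [dist_eq_norm, hkey]
  have hq : ‖(g s - G N s) * I N s / G N s‖ ≤ ε / 2 := by
    rw [norm_div, norm_mul, div_le_iff₀ hGp]
    calc ‖g s - G N s‖ * ‖I N s‖ ≤ ε * m / (4 * M') * M' := by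
          gcongr
          exact h2'.2.le
      _ = ε / 2 * (m / 2) := by field_simp; ring
      _ ≤ ε / 2 * ‖G N s‖ := by gcongr
  calc _ ≤ ‖l s - I N s‖ + ‖(g s - G N s) * I N s / G N s‖ := norm_sub_le _ _
    _ < ε / 2 + ε / 2 := add_lt_add_of_lt_of_le h3'.2 hq
    _ = ε := add_halves ε

/-! ### The knots and the rescaled identity for the bracket -/

/-- The polynomial `∏ (1 + t / (b² v))` over the positive knots `v`. -/
def scaledKnotPoly (p : ℝ[X]) (b u : ℝ) : ℝ[X] :=
  ∏ v ∈ (knots p u).erase 0, (1 + C ((b ^ 2 * v)⁻¹) * X)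

theorem eval_scaledKnotPoly (p : ℝ[X]) (b u t : ℝ) :
    (scaledKnotPoly p b u).eval t = ∏ v ∈ (knots p u).erase 0, (1 + (b ^ 2 * v)⁻¹ * t) := by
  simp [scaledKnotPoly, eval_prod]

theorem knots_erase_zero {p : ℝ[X]} {u : ℝ} (hu : 0 < u) :
    (knots p u).erase 0 = insert (u ^ 2) ((posZeros p).image (fun x => x ^ 2)) := by
  rw [knots, Finset.erase_insert]
  simp only [Finset.mem_insert, Finset.mem_image, not_or, not_exists, not_and]
  exact ⟨(pow_pos hu 2).ne, fun x hx => (pow_pos (pos_of_mem_posZeros hx) 2).ne'⟩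

theorem sq_injOn_posZeros (p : ℝ[X]) : Set.InjOn (fun x : ℝ => x ^ 2) (posZeros p) :=
  fun _ hx _ hy h => (sq_eq_sq₀ (pos_of_mem_posZeros hx).le (pos_of_mem_posZeros hy).le).1 h

theorem sq_notMem_image_posZeros {p : ℝ[X]} {u : ℝ} (hu : 0 < u) (hup : u ∉ posZeros p) :
    u ^ 2 ∉ (posZeros p).image (fun x => x ^ 2) := by
  rw [Finset.mem_image]
  rintro ⟨x, hx, h⟩
  rw [sq_eq_sq₀ (pos_of_mem_posZeros hx).le hu.le] at h
  exact hup (h ▸ hx)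

theorem prod_knots_erase_zero {M : Type*} [CommMonoid M] {p : ℝ[X]} {u : ℝ} (hu : 0 < u)
    (hup : u ∉ posZeros p) (f : ℝ → M) :
    ∏ v ∈ (knots p u).erase 0, f v = f (u ^ 2) * ∏ x ∈ posZeros p, f (x ^ 2) := by
  rw [knots_erase_zero hu, Finset.prod_insert (sq_notMem_image_posZeros hu hup),
    Finset.prod_image (sq_injOn_posZeros p)]

theorem zero_mem_knots (p : ℝ[X]) (u : ℝ) : 0 ∈ knots p u := Finset.mem_insert_self _ _

theorem card_knots {p : ℝ[X]} {u : ℝ} (hu : 0 < u) (hup : u ∉ posZeros p) :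
    (knots p u).card = (posZeros p).card + 2 := by
  rw [← Finset.card_erase_add_one (zero_mem_knots p u), knots_erase_zero hu,
    Finset.card_insert_of_notMem (sq_notMem_image_posZeros hu hup),
    Finset.card_image_of_injOn (sq_injOn_posZeros p)]

theorem knots_nonneg {p : ℝ[X]} {u v : ℝ} (hv : v ∈ knots p u) : 0 ≤ v := by
  simp only [knots, Finset.mem_insert, Finset.mem_image] at hv
  rcases hv with rfl | rfl | ⟨x, _, rfl⟩
  · exact le_rfl
  · positivity
  · positivity

theorem knots_le_maxKnot {p : ℝ[X]} {u v : ℝ} (hv : v ∈ knots p u) : v ≤ maxKnot p u :=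
  Finset.le_max' _ _ hv

theorem maxKnot_nonneg (p : ℝ[X]) (u : ℝ) : 0 ≤ maxKnot p u :=
  knots_le_maxKnot (zero_mem_knots p u)

theorem inv_ofReal_cpow_neg {x : ℝ} (hx : 0 < x) (s : ℂ) :
    ((x⁻¹ : ℝ) : ℂ) ^ (-s) = (x : ℂ) ^ s := by
  have harg : (x : ℂ).arg ≠ Real.pi := by
    rw [Complex.arg_ofReal_of_nonneg hx.le]; exact Real.pi_pos.ne
  rw [Complex.ofReal_inv, Complex.inv_cpow _ _ harg, Complex.cpow_neg, inv_inv]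

/-- The polynomials `(1 + t / N) ^ (N + 2)`. -/
def expPoly (N : ℕ) : ℝ[X] := ∏ _i ∈ Finset.range (N + 2), (1 + C (N : ℝ)⁻¹ * X)

theorem eval_expPoly (N : ℕ) (t : ℝ) : (expPoly N).eval t = (1 + (N : ℝ)⁻¹ * t) ^ (N + 2) := by
  simp [expPoly]

theorem tendsto_eval_expPoly (t : ℝ) :
    Tendsto (fun N => (expPoly N).eval t) atTop (𝓝 (Real.exp t)) := by
  have h1 := Real.tendsto_one_add_div_pow_exp t
  have h2 : Tendsto (fun N : ℕ => (1 + (N : ℝ)⁻¹ * t) ^ 2) atTop (𝓝 1) := by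
    simpa using ((tendsto_inv_atTop_nhds_zero_nat (𝕜 := ℝ)).mul_const t).const_add 1 |>.pow 2
  have h3 := h1.mul h2
  rw [mul_one] at h3
  refine h3.congr fun N => ?_
  rw [eval_expPoly, pow_add]
  ring

/-- Rescaling by `N` gives `N ^ (σ + 1)`, which cancels the power of `N` in the bracket. Rescaling
by `b ^ 2` gives `b ^ (2σ) = b ^ (s - d)`, and normalizing each factor `v + w` to constant term 1
releases the product `u² ∏ x²` of the positive knots. -/
theorem bracket_mul_mellin {d N : ℕ} {p : ℝ[X]} {b u : ℝ} {s : ℂ} (hN : 1 ≤ N)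
    (hcard : (posZeros p).card = N) (hb : 0 < b) (hu : 0 < u) (hup : u ∉ posZeros p)
    (hs : (d : ℝ) < s.re) (hsN : ((s - d) / 2).re < N + 1) :
    bracket d N p b u s *
      mellin (fun t => ((((expPoly N).eval t)⁻¹ : ℝ) : ℂ)) ((s - d) / 2 + 1) =
    mellin (fun t => ((((scaledKnotPoly p b u).eval t)⁻¹ : ℝ) : ℂ)) ((s - d) / 2) := by
  set σ := (s - d) / 2 with hσ
  have hσ0 : 0 < σ.re := by
    have : σ.re = (s.re - d) / 2 := by simp [hσ]
    rw [this]; linarith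
  have hN0 : (0 : ℝ) < N := by exact_mod_cast hN
  have hNc : (N : ℂ) ≠ 0 := by exact_mod_cast hN0.ne'
  have hbc : (b : ℂ) ≠ 0 := by exact_mod_cast hb.ne'
  have hid := integral_bSplineStar_mul_mellin hN (by rw [card_knots hu hup, hcard])
    (fun v hv => knots_nonneg hv) (zero_mem_knots p u) (maxKnot_nonneg p u)
    (fun v hv => knots_le_maxKnot hv) hσ0 hsN
  have hG : mellin (fun t => ((((expPoly N).eval t)⁻¹ : ℝ) : ℂ)) (σ + 1) =
      (N : ℂ) ^ (σ + 1) * mellin (fun w : ℝ => ((((1 + w) ^ (N + 2))⁻¹ : ℝ) : ℂ)) (σ + 1) := by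
    have h := mellin_comp_mul_left (fun w : ℝ => ((((1 + w) ^ (N + 2))⁻¹ : ℝ) : ℂ)) (σ + 1)
      (inv_pos.2 hN0)
    rw [inv_ofReal_cpow_neg hN0, smul_eq_mul, Complex.ofReal_natCast] at h
    simp only [eval_expPoly]
    exact h
  have hprod0 : ∀ v ∈ (knots p u).erase 0, 0 < v := fun v hv =>
    lt_of_le_of_ne (knots_nonneg (Finset.mem_of_mem_erase hv)) (Finset.ne_of_mem_erase hv).symm
  have hI : mellin (fun t => ((((scaledKnotPoly p b u).eval t)⁻¹ : ℝ) : ℂ)) σ =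
      (b : ℂ) ^ (s - d) * ((∏ v ∈ (knots p u).erase 0, v : ℝ) : ℂ) *
      mellin (fun w : ℝ => (((∏ v ∈ (knots p u).erase 0, (v + w))⁻¹ : ℝ) : ℂ)) σ := by
    have h := mellin_comp_mul_left (fun w : ℝ =>
      (((∏ v ∈ (knots p u).erase 0, (v + w))⁻¹ : ℝ) : ℂ)) σ (inv_pos.2 (pow_pos hb 2))
    have hb2 : ((b ^ 2 : ℝ) : ℂ) ^ σ = (b : ℂ) ^ (s - d) := by
      rw [show s - (d : ℂ) = σ + σ by rw [hσ]; ring, Complex.cpow_add _ _ hbc, pow_two,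
        Complex.ofReal_mul, Complex.mul_cpow_ofReal_nonneg hb.le hb.le]
    rw [inv_ofReal_cpow_neg (pow_pos hb 2), hb2] at h
    rw [mul_right_comm, ← smul_eq_mul ((b : ℂ) ^ (s - d)), ← h, mul_comm, ← smul_eq_mul,
      ← mellin_const_smul]
    congr 1
    ext t
    rw [eval_scaledKnotPoly, smul_eq_mul, ← Complex.ofReal_mul]
    congr 1
    have : ∏ v ∈ (knots p u).erase 0, (v + (b ^ 2)⁻¹ * t) =
        (∏ v ∈ (knots p u).erase 0, v) *
          ∏ v ∈ (knots p u).erase 0, (1 + (b ^ 2 * v)⁻¹ * t) := by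
      rw [← Finset.prod_mul_distrib]
      refine Finset.prod_congr rfl fun v hv => ?_
      have := (hprod0 v hv).ne'
      field_simp
    have hA : ∏ v ∈ (knots p u).erase 0, v ≠ 0 :=
      Finset.prod_ne_zero_iff.2 fun v hv => (hprod0 v hv).ne'
    rw [this, mul_inv, mul_inv_cancel_left₀ hA]
  have hNN : (N : ℂ) ^ (-1 - σ) * (N : ℂ) ^ (σ + 1) = 1 := by
    rw [← Complex.cpow_add _ _ hNc, show -1 - σ + (σ + 1) = 0 by ring, Complex.cpow_zero]
  have hA : ((u ^ 2 * ∏ x ∈ posZeros p, x ^ 2 : ℝ) : ℂ) =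
      (u : ℂ) ^ 2 * ∏ x ∈ posZeros p, (x : ℂ) ^ 2 := by
    push_cast
    rfl
  rw [hG, hI, ← hid, prod_knots_erase_zero hu hup, bracket, hA]
  simp only [integrandB, ← hσ]
  linear_combination ((u : ℂ) ^ 2 * (b : ℂ) ^ (s - d) * (∏ x ∈ posZeros p, (x : ℂ) ^ 2) *
    (∫ t in (0 : ℝ)..maxKnot p u, (bSplineStar N (knots p u) t : ℂ) * (t : ℂ) ^ (σ - 1)) *
    mellin (fun w : ℝ => ((((1 + w) ^ (N + 2))⁻¹ : ℝ) : ℂ)) (σ + 1)) * hNN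

/-! ### Passage to the limit -/

theorem integrandH_eq {d : ℕ} (s : ℂ) {t : ℝ} (ht : 0 < t) :
    integrandH d s t = (t : ℂ) ^ ((s - d) / 2 - 1) • (((limitFun d t)⁻¹ : ℝ) : ℂ) := by
  have htc : (t : ℂ) ≠ 0 := by exact_mod_cast ht.ne'
  have h1 : ((Real.sqrt t : ℝ) : ℂ) ^ d = (t : ℂ) ^ ((d : ℂ) / 2) := by
    rw [Real.sqrt_eq_rpow, Complex.ofReal_cpow ht.le, ← Complex.cpow_nat_mul]
    congr 1
    push_cast
    ring
  rw [integrandH, limitFun, smul_eq_mul,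
    show s / 2 - 1 = (s - d) / 2 - 1 + (d : ℂ) / 2 by ring, Complex.cpow_add _ _ htc, ← h1]
  push_cast
  rw [inv_div, mul_div_assoc]

theorem integral_integrandH (d : ℕ) (s : ℂ) :
    ∫ t in Set.Ioi (0 : ℝ), integrandH d s t =
      mellin (fun t => (((limitFun d t)⁻¹ : ℝ) : ℂ)) ((s - d) / 2) :=
  setIntegral_congr_fun measurableSet_Ioi fun _ ht => integrandH_eq s ht

theorem mellin_inv_exp {s : ℂ} (hs : 0 < s.re) :
    mellin (fun t => (((Real.exp t)⁻¹ : ℝ) : ℂ)) s = Complex.Gamma s := by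
  rw [Complex.Gamma_eq_integral hs, Complex.GammaIntegral, mellin]
  refine setIntegral_congr_fun measurableSet_Ioi fun t _ => ?_
  rw [smul_eq_mul, mul_comm, Real.exp_neg]

/-- Γ is continuous and zero-free on the right half-plane, so its modulus attains a positive minimum
on a compact subset. -/
theorem exists_le_norm_Gamma {K : Set ℂ} (hK : IsCompact K) (hpos : ∀ s ∈ K, 0 < s.re) :
    ∃ m, 0 < m ∧ ∀ s ∈ K, m ≤ ‖Complex.Gamma s‖ := by
  rcases K.eq_empty_or_nonempty with rfl | hne
  · exact ⟨1, one_pos, by simp⟩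
  have hc : ContinuousOn (fun s => ‖Complex.Gamma s‖) K := by
    refine ContinuousOn.norm fun s hs => ?_
    refine (Complex.differentiableAt_Gamma s fun m h => ?_).continuousAt.continuousWithinAt
    have := hpos s hs
    rw [h] at this
    simp at this
    linarith [(Nat.cast_nonneg m : (0 : ℝ) ≤ m)]
  obtain ⟨s₀, hs₀, hmin⟩ := hK.exists_isMinOn hne hc
  exact ⟨_, norm_pos_iff.2 (Complex.Gamma_ne_zero_of_re_pos (hpos s₀ hs₀)), fun s hs => hmin hs⟩

section

variable {d : ℕ} {β γ δ : ℕ → ℝ} {P : ℕ → ℝ[X]} {u : ℕ → ℝ}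

/-- The extra knot contributes 1 + t/(β_N u_N)², which tends to 1; the zeros of P contribute the
limit function. -/
theorem tendsto_eval_scaledKnotPoly (hd : d = 0 ∨ d = 1) (hP : ClassP d β γ δ P)
    (hu_pos : ∀ N, 1 ≤ N → 0 < u N) (hu_ne : ∀ N, 1 ≤ N → u N ∉ posZeros (P N))
    (hu_lim : Tendsto (fun N => β N * u N) atTop atTop) {t : ℝ} (ht : 0 < t) :
    Tendsto (fun N => (scaledKnotPoly (P N) (β N) (u N)).eval t) atTop (𝓝 (limitFun d t)) := by
  have h1 := hP.tendsto_prod hd ht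
  have h2 : Tendsto (fun N => 1 + (β N ^ 2 * u N ^ 2)⁻¹ * t) atTop (𝓝 1) := by
    have h := ((hu_lim.inv_tendsto_atTop.pow 2).mul_const t).const_add 1
    simp only [ne_eq, OfNat.ofNat_ne_zero, not_false_eq_true, zero_pow, zero_mul, add_zero] at h
    refine h.congr fun N => ?_
    simp only [Pi.inv_apply, inv_pow, mul_pow]
  have h3 := h2.mul h1
  rw [one_mul] at h3
  refine h3.congr' ?_
  filter_upwards [eventually_ge_atTop 1] with N hN
  rw [eval_scaledKnotPoly, prod_knots_erase_zero (hu_pos N hN) (hu_ne N hN)]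

theorem mellin_limitFun (hd : d = 0 ∨ d = 1) (hP : ClassP d β γ δ P)
    (hu_pos : ∀ N, 1 ≤ N → 0 < u N) (hu_ne : ∀ N, 1 ≤ N → u N ∉ posZeros (P N))
    (hu_lim : Tendsto (fun N => β N * u N) atTop atTop) {a : ℝ} (ha : 0 < a) :
    (∀ s : ℂ, s.re = a → MellinConvergent (fun t => (((limitFun d t)⁻¹ : ℝ) : ℂ)) s) ∧
    (∃ M : ℝ, ∀ s : ℂ, s.re = a → ‖mellin (fun t => (((limitFun d t)⁻¹ : ℝ) : ℂ)) s‖ ≤ M) ∧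
    TendstoUniformlyOn (fun N s =>
        mellin (fun t => ((((scaledKnotPoly (P N) (β N) (u N)).eval t)⁻¹ : ℝ) : ℂ)) s)
      (mellin (fun t => (((limitFun d t)⁻¹ : ℝ) : ℂ))) atTop {s | s.re = a} := by
  have hcoeff := fun N => coeff_prod_one_add_C_mul_X ((knots (P N) (u N)).erase 0)
    (c := fun v => (β N ^ 2 * v)⁻¹) fun v hv =>
      inv_nonneg.2 (mul_nonneg (sq_nonneg _) (knots_nonneg (Finset.mem_of_mem_erase hv)))
  exact tendstoUniformlyOn_mellin_inv (.of_forall fun N => (hcoeff N).1)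
    (.of_forall fun N => (hcoeff N).2)
    (fun t ht => tendsto_eval_scaledKnotPoly hd hP hu_pos hu_ne hu_lim ht)
    (exists_mul_pow_le_limitFun hd) ha

theorem tendstoUniformlyOn_Gamma_mul_bracket (hd : d = 0 ∨ d = 1) (hP : ClassP d β γ δ P)
    (hu_pos : ∀ N, 1 ≤ N → 0 < u N) (hu_ne : ∀ N, 1 ≤ N → u N ∉ posZeros (P N))
    (hu_lim : Tendsto (fun N => β N * u N) atTop atTop) {r : ℝ} (hr : (d : ℝ) < r) {K : Set ℂ}
    (hK : IsCompact K) (hKr : K ⊆ {s : ℂ | s.re = r}) :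
    TendstoUniformlyOn (fun (N : ℕ) (s : ℂ) => Complex.Gamma (1 + (s - d) / 2) *
        bracket d N (P N) (β N) (u N) s)
      (fun s => ∫ t in Set.Ioi (0 : ℝ), integrandH d s t) atTop K := by
  set a : ℝ := (r - d) / 2 with ha_def
  have ha : 0 < a := by rw [ha_def]; linarith
  have hre : ∀ s ∈ K, ((s - d) / 2).re = a := fun s hs => by
    have : s.re = r := hKr hs
    simp [ha_def, this]
  have hre1 : ∀ s ∈ K, ((s - d) / 2 + 1).re = a + 1 := fun s hs => by
    rw [Complex.add_re, hre s hs, Complex.one_re]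
  obtain ⟨-, ⟨M, hM⟩, hI⟩ := mellin_limitFun hd hP hu_pos hu_ne hu_lim ha
  have hcoeff := fun N : ℕ => coeff_prod_one_add_C_mul_X (Finset.range (N + 2))
    (c := fun _ => (N : ℝ)⁻¹) fun v hv => by positivity
  have hG := (tendstoUniformlyOn_mellin_inv (p := expPoly) (.of_forall fun N => (hcoeff N).1)
    (.of_forall fun N => (hcoeff N).2) (fun t _ => tendsto_eval_expPoly t)
    exists_mul_pow_le_exp (a := a + 1) (by linarith)).2.2
  have hI' := (hI.comp fun s : ℂ => (s - d) / 2).mono (s' := K) fun s hs => hre s hs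
  have hG' := (hG.comp fun s : ℂ => (s - d) / 2 + 1).mono (s' := K) fun s hs => hre1 s hs
  have hΓ : Set.EqOn (mellin (fun t => (((Real.exp t)⁻¹ : ℝ) : ℂ)) ∘ fun s : ℂ => (s - d) / 2 + 1)
      (fun s => Complex.Gamma (1 + (s - d) / 2)) K := fun s hs => by
    simp only [Function.comp_apply]
    rw [mellin_inv_exp (by rw [hre1 s hs]; linarith), add_comm]
  have hL : Set.EqOn (mellin (fun t => (((limitFun d t)⁻¹ : ℝ) : ℂ)) ∘ fun s : ℂ => (s - d) / 2)
      (fun s => ∫ t in Set.Ioi (0 : ℝ), integrandH d s t) K := fun s _ =>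
    (integral_integrandH d s).symm
  obtain ⟨m, hm, hmΓ⟩ := exists_le_norm_Gamma
    (hK.image (f := fun s : ℂ => 1 + (s - d) / 2) (by fun_prop)) (by
      rintro _ ⟨s, hs, rfl⟩
      have := hre1 s hs
      rw [add_comm] at this
      simp only [this]
      linarith)
  refine tendstoUniformlyOn_mul_of_mul_eq (hG'.congr_right hΓ) (hI'.congr_right hL) hm
    (fun s hs => hmΓ _ (Set.mem_image_of_mem _ hs)) (M := M) (fun s hs => ?_) ?_
  · rw [integral_integrandH]
    exact hM _ (hre s hs)
  -- The product identity needs Re σ < N + 1 for the transform of (1 + w)^(-N-2) to converge, so it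
  -- holds only for large `N`, but for all `s` in `K` simultaneously.
  · filter_upwards [eventually_ge_atTop 1, eventually_ge_atTop ⌈a⌉₊] with N hN hNa s hs
    have hs' : s.re = r := hKr hs
    refine bracket_mul_mellin hN (hP.card_and_eq_prod hd hN).1 (hP.β_pos N hN) (hu_pos N hN)
      (hu_ne N hN) (by rw [hs']; exact hr) ?_
    rw [hre s hs]
    exact (Nat.ceil_le.1 hNa).trans_lt (lt_add_one _)

end

end BSplineLimit

end

theorem corollary3p10 (d : ℕ) (hd : d = 0 ∨ d = 1) (β γ δ : ℕ → ℝ) (P : ℕ → ℝ[X])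
    (hP : BSplineLimit.ClassP d β γ δ P) (u : ℕ → ℝ)
    (hu_pos : ∀ N, 1 ≤ N → 0 < u N)
    (hu_ne : ∀ N, 1 ≤ N → u N ∉ BSplineLimit.posZeros (P N))
    (hu_lim : Tendsto (fun N => β N * u N) atTop atTop) :
    -- both integrals exist, and the limit relation holds
    (∀ s : ℂ, (d : ℝ) < s.re →
      (∀ N, 1 ≤ N → IntervalIntegrable (BSplineLimit.integrandB d N (P N) (u N) s) volume
        0 (BSplineLimit.maxKnot (P N) (u N))) ∧
      IntegrableOn (BSplineLimit.integrandH d s) (Set.Ioi 0) ∧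
      Tendsto (fun N : ℕ => Complex.Gamma (1 + (s - d) / 2) *
          BSplineLimit.bracket d N (P N) (β N) (u N) s) atTop
        (𝓝 (∫ t in Set.Ioi (0 : ℝ), BSplineLimit.integrandH d s t))) ∧
    -- uniform convergence on the compact subsets of vertical lines
    (∀ r : ℝ, (d : ℝ) < r → ∀ K : Set ℂ, IsCompact K → K ⊆ {s : ℂ | s.re = r} →
      TendstoUniformlyOn (fun (N : ℕ) (s : ℂ) => Complex.Gamma (1 + (s - d) / 2) *
          BSplineLimit.bracket d N (P N) (β N) (u N) s)
        (fun s => ∫ t in Set.Ioi (0 : ℝ), BSplineLimit.integrandH d s t) atTop K) := by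
  refine ⟨fun s hs => ⟨fun N hN => ?_, ?_, ?_⟩, fun r hr K hK hKr =>
    BSplineLimit.tendstoUniformlyOn_Gamma_mul_bracket hd hP hu_pos hu_ne hu_lim hr hK hKr⟩
  · refine BSplineLimit.intervalIntegrable_bSplineStar_mul_cpow hN ?_
      (fun v hv => BSplineLimit.knots_nonneg hv) (BSplineLimit.zero_mem_knots _ _)
      (BSplineLimit.maxKnot_nonneg _ _) ?_
    · rw [BSplineLimit.card_knots (hu_pos N hN) (hu_ne N hN), (hP.card_and_eq_prod hd hN).1]
    · have : ((s - d) / 2).re = (s.re - d) / 2 := by simp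
      rw [this]
      linarith
  · have h := (BSplineLimit.mellin_limitFun hd hP hu_pos hu_ne hu_lim
      (a := (s.re - d) / 2) (by linarith)).1 ((s - d) / 2) (by simp)
    exact IntegrableOn.congr_fun h (fun t ht => (BSplineLimit.integrandH_eq s ht).symm)
      measurableSet_Ioi
  -- The pointwise limit is the uniform statement on the compact set `{s}`.
  · exact (BSplineLimit.tendstoUniformlyOn_Gamma_mul_bracket hd hP hu_pos hu_ne hu_lim hs
      (isCompact_singleton (x := s)) (by rintro _ rfl; rfl)).tendsto_at (Set.mem_singleton s)
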